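/- Let $\delta>0$. For $f:\mathbb Z\to\mathbb R$ put $(\Delta^\delta f)_\kappa=\delta^{-2}(f_{\kappa+1}+f_{\kappa-1}-2f_\kappa)$. Let $\ell^1_{2,c}$ (which depends on $\delta$) be the set of all $f:\mathbb Z\to\mathbb R$ with $\sum_\kappa|f_\kappa|<\infty$, $\sum_\kappa(\delta\kappa)^2|f_\kappa|<\infty$ and $\sum_\kappa(\delta\kappa)f_\kappa=0$, and let $\mathcal P^\delta_{2,c}$ be the set of all $\rho\in\ell^1_{2,c}$ with $\rho_\kappa\ge0$ for all $\kappa$ and $\delta\sum_\kappa\rho_\kappa=1$. For $\rho^0,\rho^1\in\mathcal P^\delta_{2,c}$ let $\mathcal C(\rho^0,\rho^1)$ be the set of all pairs $(\rho,\mathfrak w):[0,1]\to\ell^1_{2,c}\times\ell^2(\mathbb Z)$ such that $\rho_\kappa\in H^1([0,1])$ (taken as its continuous representative) and $\mathfrak w_\kappa\in L^2([0,1])$ for each $\kappa\in\mathbb Z$, $\dot\rho_\kappa(s)=(\Delta^\delta\mathfrak w(s))_\kappa$ for each $\kappa$ and almost every $s\in[0,1]$, and $\rho(0)=\rho^0$,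 $\rho(1)=\rho^1$. The action of such a pair is $$\mathfrak A^\delta(\rho,\mathfrak w)=\delta\sum_{\kappa\in\mathbb Z}\int_0^1\frac{\mathfrak w_\kappa(s)^2}{\rho_\kappa(s)}\,\mathrm ds\in[0,\infty],$$ where the quotient $p^2/r$ is read as $0$ if $p=r=0$, and as $+\infty$ if $r=0\ne p$ or if $r<0$. **Proposition.** For every $\alpha>0$ there is a function $A=A_\alpha:\mathbb R\times\mathbb R\to[0,\infty)$ such that the following holds for every $\delta>0$. If $\rho^0,\rho^1\in\mathcal P^\delta_{2,c}$ satisfy $$R^0:=\delta\sum_\kappa e^{\alpha(\delta\kappa)^2}\rho^0_\kappa<\infty,\qquad R^1:=\delta\sum_\kappa e^{\alpha(\delta\kappa)^2}\rho^1_\kappa<\infty,$$ then there is a curve $(\rho,\mathfrak w)\in\mathcal C(\rho^0,\rho^1)$ with $\mathfrak A^\delta(\rho,\mathfrak w)\le A(R^0,R^1)<\infty$. In particular, the bound does not depend on $\delta$. -/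

import Mathlib

open scoped ENNReal NNReal

noncomputable section

namespace DiffusiveTransport

open MeasureTheory Set

/-- The discrete Laplacian with mesh size `δ` of a grid function `f : ℤ → ℝ`. -/
def laplacian (δ : ℝ) (f : ℤ → ℝ) (κ : ℤ) : ℝ :=
  (f (κ + 1) + f (κ - 1) - 2 * f κ) / δ ^ 2

/-- The first moment `δ ∑ (δ κ) f κ`. -/
def firstMoment (δ : ℝ) (f : ℤ → ℝ) : ℝ := δ * ∑' κ : ℤ, (δ * κ) * f κ

/-- The space of absolutely summable grid functions with absolutely convergent second moment and
vanishing first moment.  (The first two conditions make the series of the first moment converge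
absolutely.) -/
def ell1TwoC (δ : ℝ) : Set (ℤ → ℝ) :=
  {f | Memℓp f 1 ∧ Summable (fun κ : ℤ => (δ * κ) ^ 2 * |f κ|) ∧ firstMoment δ f = 0}

/-- The centered probability densities of finite second moment on the grid of mesh size `δ`. -/
def probTwoC (δ : ℝ) : Set (ℤ → ℝ) :=
  {ρ | ρ ∈ ell1TwoC δ ∧ (∀ κ, 0 ≤ ρ κ) ∧ δ * ∑' κ : ℤ, ρ κ = 1}

/-- The function `p ^ 2 / r` for `r > 0`, with value `0` at `p = r = 0` and `+∞` at `r = 0`, `p ≠ 0`.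
It is continued by its value `+∞` to `r < 0`, as usual for convex functions. -/
def quadOver (p r : ℝ) : ℝ≥0∞ :=
  if 0 < r then ENNReal.ofReal (p ^ 2 / r) else if r = 0 ∧ p = 0 then 0 else ⊤

/-- The Sobolev space `H¹([0,1])`, each element being given by its continuous representative: the
absolutely continuous functions on `[0,1]` whose (almost everywhere defined) derivative is square
integrable. -/
def MemH1 (f : ℝ → ℝ) : Prop :=
  AbsolutelyContinuousOnInterval f 0 1 ∧ MemLp (deriv f) 2 (volume.restrict (Icc (0 : ℝ) 1))

/-- The curves `(ρ, w) : [0,1] → ℓ¹_{2,c} × ℓ²` whose components are in `H¹([0,1])` and in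
`L²([0,1])`, respectively, and which satisfy the discrete diffusion equation `ρ' = Δ w`.  Only the
restrictions of `ρ` and `w` to `[0,1]` matter. -/
structure IsCurve (δ : ℝ) (ρ w : ℝ → ℤ → ℝ) : Prop where
  mem_ell1 : ∀ s ∈ Icc (0 : ℝ) 1, ρ s ∈ ell1TwoC δ
  mem_ell2 : ∀ s ∈ Icc (0 : ℝ) 1, Memℓp (w s) 2
  memH1 : ∀ κ, MemH1 (fun s => ρ s κ)
  memL2 : ∀ κ, MemLp (fun s => w s κ) 2 (volume.restrict (Icc (0 : ℝ) 1))
  diffusion : ∀ κ, ∀ᵐ s ∂(volume.restrict (Icc (0 : ℝ) 1)),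
    HasDerivAt (fun t => ρ t κ) (laplacian δ (w s) κ) s

/-- The curves with end points `ρ₀` (at `s = 0`) and `ρ₁` (at `s = 1`). -/
structure IsConnectingCurve (δ : ℝ) (ρ₀ ρ₁ : ℤ → ℝ) (ρ w : ℝ → ℤ → ℝ) : Prop
    extends IsCurve δ ρ w where
  left : ρ 0 = ρ₀
  right : ρ 1 = ρ₁

/-- The action `δ ∑ ∫₀¹ w² / ρ ds`, with values in `[0,∞]`. -/
def action (δ : ℝ) (ρ w : ℝ → ℤ → ℝ) : ℝ≥0∞ :=
  ENNReal.ofReal δ * ∑' κ : ℤ, ∫⁻ s in Icc (0 : ℝ) 1, quadOver (w s κ) (ρ s κ)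

/-- The Gaussian moment `δ ∑ exp (α (δ κ)²) ρ κ` of a grid density. -/
def gaussMoment (α δ : ℝ) (ρ : ℤ → ℝ) : ℝ :=
  δ * ∑' κ : ℤ, Real.exp (α * (δ * κ) ^ 2) * ρ κ

/-- Finiteness of the Gaussian moment, for densities `ρ ≥ 0`. -/
def HasGaussMoment (α δ : ℝ) (ρ : ℤ → ℝ) : Prop :=
  Summable fun κ : ℤ => Real.exp (α * (δ * κ) ^ 2) * ρ κ

end DiffusiveTransport

end

noncomputable section

namespace DiffusiveTransport

open MeasureTheory Set

/-! Both densities are joined through a fixed everywhere positive reference density, `expDensity`,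
proportional to exp(-4δ|κ|). Write G for it. Since G - ρᵢ has zero mass and zero first moment, it is
the Laplacian of a potential φᵢ that decays in both directions.

The curve has Bernstein coefficients (ρ₀, ρ₀, G, ρ₁, ρ₁). The doubled end coefficients make the flux
vanish to first order in s and 1 - s, so its square is of order s²(1 - s)², exactly the weight of G
in the curve. Hence w²/ρ is bounded, uniformly in s, by 24(φ₀² + φ₁²)/G (`quadOver_bernstein_le`).

It remains to bound δ ∑ φᵢ²/G independently of δ. The Gaussian moment controls the moment with
weight exp(3δ|κ|), which gives φᵢ the decay exp(-5δ|κ|/2) (`abs_secondPrimitive_le`); thus φᵢ²/G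
decays like exp(-δ|κ|). For large δ the two exponential sums that appear each grow like 1 + δ, which
is offset by a factor 1/(1 + δ) gained in the bound for φᵢ. -/

theorem memℓp_one_iff_summable_abs {f : ℤ → ℝ} : Memℓp f 1 ↔ Summable fun κ => |f κ| := by
  rw [memℓp_gen_iff (by norm_num)]
  simp

theorem memℓp_two_iff_summable_sq {f : ℤ → ℝ} : Memℓp f 2 ↔ Summable fun κ => f κ ^ 2 := by
  rw [memℓp_gen_iff (by norm_num)]
  simp

theorem MemH1.of_hasDerivAt {f f' : ℝ → ℝ} (hf : ∀ s, HasDerivAt f (f' s) s)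
    (hf' : Continuous f') : MemH1 f := by
  have hd : deriv f = f' := funext fun s => (hf s).deriv
  obtain ⟨C, hC⟩ := isCompact_Icc.exists_bound_of_continuousOn (s := Icc (0 : ℝ) 1) hf'.continuousOn
  refine ⟨?_, ?_⟩
  · refine LipschitzOnWith.absolutelyContinuousOnInterval (K := C.toNNReal) ?_
    rw [uIcc_of_le zero_le_one]
    refine (convex_Icc 0 1).lipschitzOnWith_of_nnnorm_hasDerivWithin_le
      (fun s _ => (hf s).hasDerivWithinAt) fun s hs => ?_
    exact NNReal.le_toNNReal_of_coe_le (hC s hs)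
  · rw [hd]
    refine MemLp.of_bound hf'.aestronglyMeasurable C ?_
    exact (ae_restrict_iff' measurableSet_Icc).2 (Filter.Eventually.of_forall hC)

theorem memLp_two_of_continuous {g : ℝ → ℝ} (hg : Continuous g) :
    MemLp g 2 (volume.restrict (Icc (0 : ℝ) 1)) := by
  obtain ⟨C, hC⟩ := isCompact_Icc.exists_bound_of_continuousOn (s := Icc (0 : ℝ) 1) hg.continuousOn
  refine MemLp.of_bound hg.aestronglyMeasurable C ?_
  exact (ae_restrict_iff' measurableSet_Icc).2 (Filter.Eventually.of_forall hC)

/-! ### Exponential sums on the grid, compared uniformly in the mesh size -/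

/-- Two-sided geometric series. -/
theorem hasSum_exp_neg_abs {a : ℝ} (ha : 0 < a) :
    HasSum (fun k : ℤ => Real.exp (-(a * |(k : ℝ)|)))
      ((1 + Real.exp (-a)) / (1 - Real.exp (-a))) := by
  set q := Real.exp (-a) with hq
  have hq0 : 0 ≤ q := (Real.exp_pos _).le
  have hq1 : q < 1 := by rw [hq]; simpa using ha
  have hg := hasSum_geometric_of_lt_one hq0 hq1
  have hpow : ∀ n : ℕ, Real.exp (-(a * n)) = q ^ n := fun n => by
    rw [hq, ← Real.exp_nat_mul]; ring_nf
  have := HasSum.of_nat_of_neg_add_one (f := fun k : ℤ => Real.exp (-(a * |(k : ℝ)|)))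
    (m := (1 - q)⁻¹) (m' := q * (1 - q)⁻¹) ?_ ?_
  · convert this using 1
    field_simp
  · simpa [hpow] using hg
  · refine (funext fun n : ℕ => ?_ : (fun n : ℕ => Real.exp (-(a * |((-((n : ℤ) + 1) : ℤ) : ℝ)|)))
      = fun n => q * q ^ n) ▸ hg.mul_left q
    have : |((-((n : ℤ) + 1) : ℤ) : ℝ)| = ((n + 1 : ℕ) : ℝ) := by
      push_cast; rw [abs_neg, abs_of_nonneg (by positivity)]
    rw [this, hpow, pow_succ']

/-- The sum `δ ∑ exp (-a |δ κ|)`. -/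
def expSum (a δ : ℝ) : ℝ := δ * ∑' k : ℤ, Real.exp (-(a * δ * |(k : ℝ)|))

theorem summable_exp_neg_abs {a δ : ℝ} (ha : 0 < a) (hδ : 0 < δ) :
    Summable fun k : ℤ => Real.exp (-(a * δ * |(k : ℝ)|)) :=
  (hasSum_exp_neg_abs (mul_pos ha hδ)).summable

theorem expSum_eq {a δ : ℝ} (ha : 0 < a) (hδ : 0 < δ) :
    expSum a δ = δ * ((1 + Real.exp (-(a * δ))) / (1 - Real.exp (-(a * δ)))) := by
  rw [expSum, (hasSum_exp_neg_abs (mul_pos ha hδ)).tsum_eq]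

theorem expSum_pos {a δ : ℝ} (ha : 0 < a) (hδ : 0 < δ) : 0 < expSum a δ := by
  have : Real.exp (-(a * δ)) < 1 := by simpa using mul_pos ha hδ
  rw [expSum_eq ha hδ]
  have := sub_pos.2 this
  positivity

theorem expSum_one_le {δ : ℝ} (hδ : 0 < δ) : expSum 1 δ ≤ 2 * (1 + δ) := by
  rw [expSum_eq one_pos hδ, one_mul]
  have h1 : Real.exp (-δ) < 1 := by simpa using hδ
  have h2 : Real.exp (-δ) * (1 + δ) ≤ 1 := by
    have h := Real.add_one_le_exp δ
    calc Real.exp (-δ) * (1 + δ) ≤ Real.exp (-δ) * Real.exp δ := by gcongr; linarith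
      _ = 1 := by rw [← Real.exp_add]; simp
  rw [mul_div_assoc', div_le_iff₀ (by linarith)]
  nlinarith

theorem expSum_four_le {δ : ℝ} (hδ : 0 < δ) : expSum 4 δ ≤ expSum 1 δ := by
  unfold expSum
  refine mul_le_mul_of_nonneg_left ?_ hδ.le
  refine Summable.tsum_le_tsum (fun k => ?_) (summable_exp_neg_abs four_pos hδ)
    (summable_exp_neg_abs one_pos hδ)
  have := mul_nonneg hδ.le (abs_nonneg (k : ℝ))
  refine Real.exp_le_exp.2 ?_
  nlinarith

theorem expSum_one_le_expSum_four {δ : ℝ} (hδ : 0 < δ) : expSum 1 δ ≤ 8 * expSum 4 δ := by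
  rw [expSum_eq one_pos hδ, expSum_eq four_pos hδ, one_mul]
  have h4 : Real.exp (-(4 * δ)) = Real.exp (-δ) ^ 4 := by
    rw [← Real.exp_nat_mul]; congr 1; push_cast; ring
  rw [h4]
  have h0 := Real.exp_pos (-δ)
  have h1 : Real.exp (-δ) < 1 := by simpa using hδ
  generalize Real.exp (-δ) = r at *
  have hr4 : r ^ 4 < 1 := pow_lt_one₀ h0.le h1 (by norm_num)
  -- After cancelling 1 - r, the left side is (1 + r)²(1 + r²), at most 4 · 2.
  have h : (1 + r) / (1 - r) ≤ 8 * ((1 + r ^ 4) / (1 - r ^ 4)) := by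
    rw [mul_div_assoc', div_le_div_iff₀ (by linarith) (by linarith)]
    have e : (1 + r) * (1 - r ^ 4) = (1 - r) * ((1 + r) ^ 2 * (1 + r ^ 2)) := by ring
    have h3 : (1 + r) ^ 2 * (1 + r ^ 2) ≤ 8 * (1 + r ^ 4) := by
      have : (1 + r) ^ 2 ≤ 4 := by nlinarith
      have : r ^ 2 ≤ 1 := by nlinarith
      have : 0 ≤ r ^ 4 := by positivity
      nlinarith [sq_nonneg r]
    rw [e]
    nlinarith
  nlinarith

/-! ### Centered grid functions and decay of their second primitive -/

section Moments

variable {δ : ℝ} {f g : ℤ → ℝ}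

theorem summable_of_mem_ell1TwoC (hf : f ∈ ell1TwoC δ) : Summable f :=
  (memℓp_one_iff_summable_abs.1 hf.1).of_abs

theorem summable_mul_of_mem_ell1TwoC (hf : f ∈ ell1TwoC δ) :
    Summable fun κ : ℤ => (δ * κ) * f κ := by
  refine Summable.of_norm_bounded ((memℓp_one_iff_summable_abs.1 hf.1).add hf.2.1) fun κ => ?_
  rw [Real.norm_eq_abs, abs_mul]
  have h1 : |δ * κ| ≤ 1 + (δ * κ) ^ 2 := by
    rw [← sq_abs (δ * κ)]
    nlinarith [sq_nonneg (|δ * κ| - 1), abs_nonneg (δ * (κ : ℝ))]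
  nlinarith [abs_nonneg (f κ)]

theorem add_mem_ell1TwoC (hf : f ∈ ell1TwoC δ) (hg : g ∈ ell1TwoC δ) :
    (fun κ => f κ + g κ) ∈ ell1TwoC δ := by
  refine ⟨hf.1.add hg.1, ?_, ?_⟩
  · refine Summable.of_nonneg_of_le (fun κ => by positivity) (fun κ => ?_) (hf.2.1.add hg.2.1)
    rw [← mul_add]
    exact mul_le_mul_of_nonneg_left (abs_add_le _ _) (sq_nonneg _)
  · have hf2 := hf.2.2
    have hg2 := hg.2.2
    unfold firstMoment at *
    simp only [mul_add]
    rw [(summable_mul_of_mem_ell1TwoC hf).tsum_add (summable_mul_of_mem_ell1TwoC hg), mul_add,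
      hf2, hg2, add_zero]

theorem const_mul_mem_ell1TwoC (c : ℝ) (hf : f ∈ ell1TwoC δ) :
    (fun κ => c * f κ) ∈ ell1TwoC δ := by
  refine ⟨hf.1.const_mul c, ?_, ?_⟩
  · refine (hf.2.1.mul_left |c|).congr fun κ => ?_
    rw [abs_mul]
    ring
  · have hf2 := hf.2.2
    unfold firstMoment at *
    simp only [mul_left_comm _ c]
    rw [tsum_mul_left, mul_left_comm, hf2, mul_zero]

theorem sub_mem_ell1TwoC (hf : f ∈ ell1TwoC δ) (hg : g ∈ ell1TwoC δ) :
    (fun κ => f κ - g κ) ∈ ell1TwoC δ := by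
  simpa [sub_eq_add_neg] using add_mem_ell1TwoC hf (const_mul_mem_ell1TwoC (-1) hg)

theorem summable_intCast_mul (hδ : 0 < δ) (hf : f ∈ ell1TwoC δ) :
    Summable fun κ : ℤ => (κ : ℝ) * f κ := by
  refine ((summable_mul_of_mem_ell1TwoC hf).mul_left δ⁻¹).congr fun κ => ?_
  field_simp

theorem tsum_intCast_mul (hδ : 0 < δ) (hf : f ∈ ell1TwoC δ) : ∑' κ : ℤ, (κ : ℝ) * f κ = 0 := by
  have h := hf.2.2
  simp only [firstMoment, mul_assoc, tsum_mul_left] at h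
  simpa [hδ.ne'] using h

/-- The second primitive `δ² ∑ (j - κ)₊ f j` of a grid function. -/
def secondPrimitive (δ : ℝ) (f : ℤ → ℝ) (κ : ℤ) : ℝ :=
  δ ^ 2 * ∑' j : ℤ, max ((j : ℝ) - κ) 0 * f j

theorem summable_max_mul (hδ : 0 < δ) (hf : f ∈ ell1TwoC δ) (κ : ℤ) :
    Summable fun j : ℤ => max ((j : ℝ) - κ) 0 * f j := by
  refine Summable.of_norm_bounded ((summable_intCast_mul hδ hf).abs.add
    ((summable_of_mem_ell1TwoC hf).abs.mul_left |(κ : ℝ)|)) fun j => ?_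
  rw [Real.norm_eq_abs, abs_mul, abs_mul, ← add_mul]
  refine mul_le_mul_of_nonneg_right ?_ (abs_nonneg _)
  rw [abs_of_nonneg (le_max_right _ _)]
  refine max_le ?_ (by positivity)
  linarith [le_abs_self (j : ℝ), neg_abs_le (κ : ℝ)]

/-- The second difference in κ of the hinge (j - κ)₊ is the Kronecker delta at j. -/
theorem laplacian_secondPrimitive (hδ : 0 < δ) (hf : f ∈ ell1TwoC δ) (κ : ℤ) :
    laplacian δ (secondPrimitive δ f) κ = f κ := by
  have hs := summable_max_mul hδ hf
  have key : ∑' j : ℤ, max ((j : ℝ) - (κ + 1 : ℤ)) 0 * f j +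
      ∑' j : ℤ, max ((j : ℝ) - (κ - 1 : ℤ)) 0 * f j -
      2 * ∑' j : ℤ, max ((j : ℝ) - κ) 0 * f j = f κ := by
    rw [← (hs _).tsum_add (hs _), ← tsum_mul_left,
      ← ((hs _).add (hs _)).tsum_sub ((hs _).mul_left 2), tsum_eq_single κ]
    · push_cast
      rw [max_eq_right (by linarith), max_eq_left (by linarith), max_eq_left (by linarith)]
      ring
    · intro j hj
      push_cast
      rcases lt_or_gt_of_ne hj with h | h
      · have h' : (j : ℝ) + 1 ≤ κ := by exact_mod_cast h
        rw [max_eq_right (by linarith), max_eq_right (by linarith), max_eq_right (by linarith)]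
        ring
      · have h' : (κ : ℝ) + 1 ≤ j := by exact_mod_cast h
        rw [max_eq_left (by linarith), max_eq_left (by linarith), max_eq_left (by linarith)]
        ring
  rw [laplacian, div_eq_iff (by positivity), ← key]
  simp only [secondPrimitive]
  ring

/-- The two hinges differ by j - κ, which integrates to zero against f because mass and first moment
vanish. The primitive is therefore also a sum over the left tail, which is what yields decay as κ →
-∞. -/
theorem secondPrimitive_eq (hδ : 0 < δ) (hf : f ∈ ell1TwoC δ) (h0 : ∑' j, f j = 0) (κ : ℤ) :
    secondPrimitive δ f κ = δ ^ 2 * ∑' j : ℤ, max ((κ : ℝ) - j) 0 * f j := by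
  have h1 := summable_intCast_mul hδ hf
  have h2 := (summable_of_mem_ell1TwoC hf).mul_left (κ : ℝ)
  have h : ∑' j : ℤ, ((j : ℝ) * f j - κ * f j) = 0 := by
    rw [h1.tsum_sub h2, tsum_intCast_mul hδ hf, tsum_mul_left, h0]
    ring
  have h3 := (summable_max_mul hδ hf κ).tsum_sub (h1.sub h2)
  rw [h, sub_zero] at h3
  rw [secondPrimitive, ← h3]
  congr 2
  funext j
  rcases le_total (j : ℝ) κ with hj | hj
  · rw [max_eq_right (by linarith), max_eq_left (by linarith)]; ring
  · rw [max_eq_left (by linarith), max_eq_right (by linarith)]; ring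

theorem mul_one_add_le_exp {x : ℝ} (hx : 0 ≤ x) : x * (1 + x) ≤ 16 * Real.exp (x / 2) := by
  have := Real.quadratic_le_exp_of_nonneg (x := x / 2) (by positivity)
  nlinarith

/-- Common tail estimate for both representations of the second primitive, with c a hinge supported
farther from 0 than κ. -/
theorem abs_tsum_mul_le (hδ : 0 < δ)
    (hf : Summable fun j : ℤ => Real.exp (3 * δ * |(j : ℝ)|) * |f j|)
    {c : ℤ → ℝ} {κ : ℤ} (hc0 : ∀ j, 0 ≤ c j) (hc : ∀ j, c j ≤ |(j : ℝ)|)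
    (hcκ : ∀ j, c j ≠ 0 → |(κ : ℝ)| ≤ |(j : ℝ)| ∧ 1 ≤ |(j : ℝ)|) :
    (1 + δ) * |δ ^ 2 * ∑' j : ℤ, c j * f j| ≤
      16 * Real.exp (-(5 / 2 * δ * |(κ : ℝ)|)) *
        (δ * ∑' j : ℤ, Real.exp (3 * δ * |(j : ℝ)|) * |f j|) := by
  have hpt : ∀ j, (1 + δ) * δ * |c j * f j| ≤
      16 * Real.exp (-(5 / 2 * δ * |(κ : ℝ)|)) * (Real.exp (3 * δ * |(j : ℝ)|) * |f j|) := by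
    intro j
    rw [abs_mul, abs_of_nonneg (hc0 j), ← mul_assoc, ← mul_assoc]
    refine mul_le_mul_of_nonneg_right ?_ (abs_nonneg _)
    by_cases h : c j = 0
    · rw [h, mul_zero]; positivity
    obtain ⟨h1, h2⟩ := hcκ j h
    -- The factor 1 + δ is affordable for large δ because only |j| ≥ 1 contributes, so that δ ≤
    -- δ|j|. Of the weight exp(3δ|j|), exp(δ|j|/2) absorbs the polynomial, and the rest becomes
    -- decay in κ through |κ| ≤ |j|.
    calc (1 + δ) * δ * c j ≤ (1 + δ * |(j : ℝ)|) * δ * |(j : ℝ)| := by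
          gcongr
          · exact hc0 j
          · exact le_mul_of_one_le_right hδ.le h2
          · exact hc j
      _ = δ * |(j : ℝ)| * (1 + δ * |(j : ℝ)|) := by ring
      _ ≤ 16 * Real.exp (δ * |(j : ℝ)| / 2) := mul_one_add_le_exp (by positivity)
      _ ≤ 16 * Real.exp (-(5 / 2 * δ * |(κ : ℝ)|) + 3 * δ * |(j : ℝ)|) := by
          have := mul_le_mul_of_nonneg_left h1 hδ.le
          gcongr
          linarith
      _ = _ := by rw [Real.exp_add]; ring
  have hs : Summable fun j => |c j * f j| := by
    refine Summable.of_nonneg_of_le (fun _ => abs_nonneg _) (fun j => ?_)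
      ((hf.mul_left (16 * Real.exp (-(5 / 2 * δ * |(κ : ℝ)|)))).mul_left ((1 + δ) * δ)⁻¹)
    rw [le_inv_mul_iff₀ (by positivity)]
    exact hpt j
  have hS : (1 + δ) * δ * |∑' j : ℤ, c j * f j| ≤ 16 * Real.exp (-(5 / 2 * δ * |(κ : ℝ)|)) *
      ∑' j : ℤ, Real.exp (3 * δ * |(j : ℝ)|) * |f j| := by
    have h1 : |∑' j : ℤ, c j * f j| ≤ ∑' j : ℤ, |c j * f j| := by
      simpa only [Real.norm_eq_abs] using norm_tsum_le_tsum_norm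
        (f := fun j => c j * f j) (by simpa only [Real.norm_eq_abs] using hs)
    have h2 := Summable.tsum_le_tsum hpt (hs.mul_left _) (hf.mul_left _)
    rw [tsum_mul_left, tsum_mul_left] at h2
    exact (mul_le_mul_of_nonneg_left h1 (by positivity)).trans h2
  generalize ∑' j : ℤ, c j * f j = S at hS ⊢
  generalize ∑' j : ℤ, Real.exp (3 * δ * |(j : ℝ)|) * |f j| = T at hS ⊢
  rw [abs_mul, abs_of_pos (by positivity : 0 < δ ^ 2)]
  calc (1 + δ) * (δ ^ 2 * |S|) = δ * ((1 + δ) * δ * |S|) := by ring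
    _ ≤ δ * _ := mul_le_mul_of_nonneg_left hS hδ.le
    _ = _ := by ring

theorem abs_secondPrimitive_le (hδ : 0 < δ) (hf : f ∈ ell1TwoC δ) (h0 : ∑' j, f j = 0)
    (hexp : Summable fun j : ℤ => Real.exp (3 * δ * |(j : ℝ)|) * |f j|) (κ : ℤ) :
    (1 + δ) * |secondPrimitive δ f κ| ≤
      16 * Real.exp (-(5 / 2 * δ * |(κ : ℝ)|)) *
        (δ * ∑' j : ℤ, Real.exp (3 * δ * |(j : ℝ)|) * |f j|) := by
  rcases le_total 0 κ with hκ | hκ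
  · have hκ' : (0 : ℝ) ≤ κ := by exact_mod_cast hκ
    refine abs_tsum_mul_le hδ hexp (fun j => le_max_right _ _)
      (fun j => max_le (by linarith [le_abs_self (j : ℝ)]) (abs_nonneg _)) fun j hj => ?_
    have hlt : κ < j := by
      by_contra! h
      have : (j : ℝ) ≤ κ := by exact_mod_cast h
      exact hj (max_eq_right (by linarith))
    have h' : (κ : ℝ) + 1 ≤ j := by exact_mod_cast hlt
    rw [abs_of_nonneg hκ', abs_of_nonneg (by linarith : (0 : ℝ) ≤ j)]
    constructor <;> linarith
  · have hκ' : (κ : ℝ) ≤ 0 := by exact_mod_cast hκ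
    rw [secondPrimitive_eq hδ hf h0]
    refine abs_tsum_mul_le hδ hexp (fun j => le_max_right _ _)
      (fun j => max_le (by linarith [neg_abs_le (j : ℝ)]) (abs_nonneg _)) fun j hj => ?_
    have hlt : j < κ := by
      by_contra! h
      have : (κ : ℝ) ≤ j := by exact_mod_cast h
      exact hj (max_eq_right (by linarith))
    have h' : (j : ℝ) + 1 ≤ κ := by exact_mod_cast hlt
    rw [abs_of_nonpos hκ', abs_of_nonpos (by linarith : (j : ℝ) ≤ 0)]
    constructor <;> linarith

end Moments

/-! ### The reference density -/

section Laplace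

variable {δ : ℝ}

/-- The centered two-sided exponential probability density on the grid of mesh size `δ`. -/
def expDensity (δ : ℝ) (κ : ℤ) : ℝ := Real.exp (-(4 * δ * |(κ : ℝ)|)) / expSum 4 δ

theorem expDensity_pos (hδ : 0 < δ) (κ : ℤ) : 0 < expDensity δ κ :=
  div_pos (Real.exp_pos _) (expSum_pos four_pos hδ)

theorem exp_mul_expDensity (κ : ℤ) : Real.exp (3 * δ * |(κ : ℝ)|) * expDensity δ κ =
    (expSum 4 δ)⁻¹ * Real.exp (-(1 * δ * |(κ : ℝ)|)) := by
  rw [expDensity, mul_div_assoc', ← Real.exp_add, div_eq_inv_mul]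
  ring_nf

theorem summable_expDensity (hδ : 0 < δ) : Summable (expDensity δ) :=
  (summable_exp_neg_abs four_pos hδ).div_const _

theorem summable_exp_mul_expDensity (hδ : 0 < δ) :
    Summable fun κ : ℤ => Real.exp (3 * δ * |(κ : ℝ)|) * expDensity δ κ := by
  simp only [exp_mul_expDensity]
  exact (summable_exp_neg_abs one_pos hδ).mul_left _

theorem tsum_exp_mul_expDensity_le (hδ : 0 < δ) :
    δ * ∑' κ : ℤ, Real.exp (3 * δ * |(κ : ℝ)|) * expDensity δ κ ≤ 8 := by
  simp only [exp_mul_expDensity]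
  rw [tsum_mul_left, mul_left_comm]
  change (expSum 4 δ)⁻¹ * expSum 1 δ ≤ 8
  rw [inv_mul_le_iff₀ (expSum_pos four_pos hδ), mul_comm]
  exact expSum_one_le_expSum_four hδ

theorem expDensity_mem (hδ : 0 < δ) : expDensity δ ∈ probTwoC δ := by
  have hpos := expDensity_pos hδ
  refine ⟨⟨memℓp_one_iff_summable_abs.2 (summable_expDensity hδ).abs, ?_, ?_⟩,
    fun κ => (hpos κ).le, ?_⟩
  · refine Summable.of_nonneg_of_le (fun κ => by positivity) (fun κ => ?_)
      ((summable_exp_mul_expDensity hδ).mul_left 2)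
    rw [abs_of_pos (hpos κ), ← mul_assoc]
    refine mul_le_mul_of_nonneg_right ?_ (hpos κ).le
    have hx : 0 ≤ δ * |(κ : ℝ)| := by positivity
    have h := Real.quadratic_le_exp_of_nonneg (x := 3 * δ * |(κ : ℝ)|) (by positivity)
    have e : (δ * κ : ℝ) ^ 2 = (δ * |(κ : ℝ)|) ^ 2 := by rw [mul_pow, mul_pow, sq_abs]
    rw [e]
    nlinarith
  · have hodd : ∑' κ : ℤ, (δ * κ) * expDensity δ κ = -∑' κ : ℤ, (δ * κ) * expDensity δ κ := by
      conv_lhs => rw [← (Equiv.neg ℤ).tsum_eq]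
      rw [← tsum_neg]
      refine tsum_congr fun κ => ?_
      simp [expDensity]
    rw [firstMoment]
    have : ∑' κ : ℤ, (δ * κ) * expDensity δ κ = 0 := by linarith
    rw [this, mul_zero]
  · simp only [expDensity]
    rw [tsum_div_const, mul_div_assoc']
    exact div_self (expSum_pos four_pos hδ).ne'

end Laplace

/-! ### Potentials of the differences to the reference density -/

section Potential

variable {α δ : ℝ} {ρ : ℤ → ℝ}

/-- Completing the square: 3x ≤ αx² + 9/(4α), with x = δ|κ|. -/
theorem exp_le_mul_exp_sq (hα : 0 < α) (κ : ℤ) : Real.exp (3 * δ * |(κ : ℝ)|) ≤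
    Real.exp (9 / (4 * α)) * Real.exp (α * (δ * κ) ^ 2) := by
  rw [← Real.exp_add, Real.exp_le_exp]
  have e : (δ * κ : ℝ) ^ 2 = (δ * |(κ : ℝ)|) ^ 2 := by rw [mul_pow, mul_pow, sq_abs]
  rw [e, mul_assoc]
  generalize δ * |(κ : ℝ)| = x
  have h : 9 / (4 * α) + α * x ^ 2 - 3 * x = (2 * α * x - 3) ^ 2 / (4 * α) := by
    field_simp
    ring
  have : 0 ≤ (2 * α * x - 3) ^ 2 / (4 * α) := by positivity
  linarith

theorem tsum_sub_eq_zero (hδ : 0 < δ) {ρ σ : ℤ → ℝ} (hρ : ρ ∈ probTwoC δ) (hσ : σ ∈ probTwoC δ) :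
    ∑' κ, (ρ κ - σ κ) = 0 := by
  rw [(summable_of_mem_ell1TwoC hρ.1).tsum_sub (summable_of_mem_ell1TwoC hσ.1), sub_eq_zero]
  exact mul_left_cancel₀ hδ.ne' (hρ.2.2.trans hσ.2.2.symm)

/-- The bound for the exponential moment of `ρ - expDensity δ`. -/
def momentBound (α R : ℝ) : ℝ := Real.exp (9 / (4 * α)) * R + 8

theorem summable_exp_mul_abs_sub_and_le (hα : 0 < α) (hδ : 0 < δ) (hρ : ρ ∈ probTwoC δ)
    (hG : HasGaussMoment α δ ρ) :
    (Summable fun κ : ℤ => Real.exp (3 * δ * |(κ : ℝ)|) * |expDensity δ κ - ρ κ|) ∧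
      δ * ∑' κ : ℤ, Real.exp (3 * δ * |(κ : ℝ)|) * |expDensity δ κ - ρ κ| ≤
        momentBound α (gaussMoment α δ ρ) := by
  have hle : ∀ κ : ℤ, Real.exp (3 * δ * |(κ : ℝ)|) * |expDensity δ κ - ρ κ| ≤
      Real.exp (9 / (4 * α)) * (Real.exp (α * (δ * κ) ^ 2) * ρ κ) +
        Real.exp (3 * δ * |(κ : ℝ)|) * expDensity δ κ := by
    intro κ
    have h1 : |expDensity δ κ - ρ κ| ≤ ρ κ + expDensity δ κ := by
      have := hρ.2.1 κ
      have := expDensity_pos hδ κ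
      rw [abs_le]
      constructor <;> linarith
    calc _ ≤ Real.exp (3 * δ * |(κ : ℝ)|) * (ρ κ + expDensity δ κ) := by gcongr
      _ = Real.exp (3 * δ * |(κ : ℝ)|) * ρ κ + Real.exp (3 * δ * |(κ : ℝ)|) * expDensity δ κ :=
        mul_add _ _ _
      _ ≤ _ := by
        rw [← mul_assoc]
        gcongr
        · exact hρ.2.1 κ
        · exact exp_le_mul_exp_sq hα κ
  have hs1 := Summable.mul_left (Real.exp (9 / (4 * α))) hG
  have hs2 := summable_exp_mul_expDensity hδ
  have hs : Summable fun κ : ℤ => Real.exp (3 * δ * |(κ : ℝ)|) * |expDensity δ κ - ρ κ| :=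
    Summable.of_nonneg_of_le (fun κ => by positivity) hle (hs1.add hs2)
  refine ⟨hs, ?_⟩
  have h := hs.tsum_le_tsum hle (hs1.add hs2)
  rw [hs1.tsum_add hs2, tsum_mul_left] at h
  have h8 := tsum_exp_mul_expDensity_le hδ
  have h' := mul_le_mul_of_nonneg_left h hδ.le
  rw [mul_add, mul_left_comm] at h'
  rw [momentBound, gaussMoment]
  linarith

/-- The grid function with discrete Laplacian `expDensity δ - ρ`. -/
def potential (δ : ℝ) (ρ : ℤ → ℝ) : ℤ → ℝ := secondPrimitive δ fun κ => expDensity δ κ - ρ κ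

theorem laplacian_potential (hδ : 0 < δ) (hρ : ρ ∈ probTwoC δ) (κ : ℤ) :
    laplacian δ (potential δ ρ) κ = expDensity δ κ - ρ κ :=
  laplacian_secondPrimitive hδ (sub_mem_ell1TwoC (expDensity_mem hδ).1 hρ.1) κ

theorem potential_sq_le (hα : 0 < α) (hδ : 0 < δ) (hρ : ρ ∈ probTwoC δ)
    (hG : HasGaussMoment α δ ρ) (κ : ℤ) :
    potential δ ρ κ ^ 2 ≤ (16 * momentBound α (gaussMoment α δ ρ) / (1 + δ)) ^ 2 *
      Real.exp (-(5 * δ * |(κ : ℝ)|)) := by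
  obtain ⟨hs, hle⟩ := summable_exp_mul_abs_sub_and_le hα hδ hρ hG
  have h := abs_secondPrimitive_le hδ (sub_mem_ell1TwoC (expDensity_mem hδ).1 hρ.1)
    (tsum_sub_eq_zero hδ (expDensity_mem hδ) hρ) hs κ
  have h2 := h.trans (mul_le_mul_of_nonneg_left hle (by positivity))
  have e : Real.exp (-(5 * δ * |(κ : ℝ)|)) = Real.exp (-(5 / 2 * δ * |(κ : ℝ)|)) ^ 2 := by
    rw [← Real.exp_nat_mul]
    congr 1
    push_cast
    ring
  rw [e, ← mul_pow, ← sq_abs]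
  refine pow_le_pow_left₀ (abs_nonneg _) ?_ 2
  rw [div_mul_eq_mul_div, le_div_iff₀ (by linarith)]
  calc |potential δ ρ κ| * (1 + δ) = (1 + δ) * |potential δ ρ κ| := mul_comm _ _
    _ ≤ _ := h2
    _ = _ := by ring

theorem memℓp_potential (hα : 0 < α) (hδ : 0 < δ) (hρ : ρ ∈ probTwoC δ)
    (hG : HasGaussMoment α δ ρ) : Memℓp (potential δ ρ) 2 :=
  memℓp_two_iff_summable_sq.2 <| Summable.of_nonneg_of_le (fun _ => sq_nonneg _)
    (potential_sq_le hα hδ hρ hG) ((summable_exp_neg_abs (by norm_num) hδ).mul_left _)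

/-- Exponents -5 from φ² and +4 from the reciprocal of the reference density leave exp(-δ|κ|). The
normalization and this sum are each at most 2(1 + δ), which cancels (1 + δ)⁻² and leaves 16² · 4 =
1024. -/
theorem summable_potential_sq_div_and_le (hα : 0 < α) (hδ : 0 < δ) (hρ : ρ ∈ probTwoC δ)
    (hG : HasGaussMoment α δ ρ) :
    (Summable fun κ => potential δ ρ κ ^ 2 / expDensity δ κ) ∧
      δ * ∑' κ, potential δ ρ κ ^ 2 / expDensity δ κ ≤
        1024 * momentBound α (gaussMoment α δ ρ) ^ 2 := by
  have hsq := potential_sq_le hα hδ hρ hG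
  generalize momentBound α (gaussMoment α δ ρ) = C at hsq ⊢
  have hZ := expSum_pos four_pos hδ
  have hle : ∀ κ : ℤ, potential δ ρ κ ^ 2 / expDensity δ κ ≤
      (16 * C / (1 + δ)) ^ 2 * expSum 4 δ * Real.exp (-(1 * δ * |(κ : ℝ)|)) := by
    intro κ
    rw [div_le_iff₀ (expDensity_pos hδ κ)]
    refine (hsq κ).trans_eq ?_
    have e : Real.exp (-(5 * δ * |(κ : ℝ)|)) =
        Real.exp (-(1 * δ * |(κ : ℝ)|)) * Real.exp (-(4 * δ * |(κ : ℝ)|)) := by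
      rw [← Real.exp_add]
      ring_nf
    rw [e, expDensity]
    field_simp
  have hs1 := (summable_exp_neg_abs one_pos hδ).mul_left ((16 * C / (1 + δ)) ^ 2 * expSum 4 δ)
  have hs : Summable fun κ => potential δ ρ κ ^ 2 / expDensity δ κ :=
    Summable.of_nonneg_of_le
      (fun κ => div_nonneg (sq_nonneg _) (expDensity_pos hδ κ).le) hle hs1
  refine ⟨hs, ?_⟩
  have h := mul_le_mul_of_nonneg_left (hs.tsum_le_tsum hle hs1) hδ.le
  rw [tsum_mul_left, mul_left_comm] at h
  refine h.trans ?_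
  change (16 * C / (1 + δ)) ^ 2 * expSum 4 δ * expSum 1 δ ≤ _
  have h1 := expSum_one_le hδ
  have h0 := (expSum_pos one_pos hδ).le
  have h4 := (expSum_four_le hδ).trans h1
  calc (16 * C / (1 + δ)) ^ 2 * expSum 4 δ * expSum 1 δ
      ≤ (16 * C / (1 + δ)) ^ 2 * (2 * (1 + δ)) * (2 * (1 + δ)) := by gcongr
    _ = _ := by
      field_simp
      ring

end Potential

/-! ### The connecting curve and its action -/

section Curve

variable {α δ : ℝ} {ρ₀ ρ₁ : ℤ → ℝ}

/-- The Bernstein curve of degree four from `ρ₀` through `expDensity δ` to `ρ₁`. -/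
def bernsteinCurve (δ : ℝ) (ρ₀ ρ₁ : ℤ → ℝ) (s : ℝ) (κ : ℤ) : ℝ :=
  (1 - s) ^ 3 * (1 + 3 * s) * ρ₀ κ + s ^ 3 * (4 - 3 * s) * ρ₁ κ +
    6 * s ^ 2 * (1 - s) ^ 2 * expDensity δ κ

/-- The flux of `bernsteinCurve`. -/
def bernsteinFlux (δ : ℝ) (ρ₀ ρ₁ : ℤ → ℝ) (s : ℝ) (κ : ℤ) : ℝ :=
  12 * s * (1 - s) ^ 2 * potential δ ρ₀ κ + -12 * s ^ 2 * (1 - s) * potential δ ρ₁ κ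

theorem laplacian_bernsteinFlux (hδ : 0 < δ) (h₀ : ρ₀ ∈ probTwoC δ) (h₁ : ρ₁ ∈ probTwoC δ)
    (s : ℝ) (κ : ℤ) : laplacian δ (bernsteinFlux δ ρ₀ ρ₁ s) κ =
      12 * s * (1 - s) ^ 2 * (expDensity δ κ - ρ₀ κ) -
        12 * s ^ 2 * (1 - s) * (expDensity δ κ - ρ₁ κ) := by
  rw [← laplacian_potential hδ h₀, ← laplacian_potential hδ h₁]
  simp only [laplacian, bernsteinFlux]
  ring

theorem hasDerivAt_bernsteinCurve (hδ : 0 < δ) (h₀ : ρ₀ ∈ probTwoC δ) (h₁ : ρ₁ ∈ probTwoC δ)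
    (κ : ℤ) (s : ℝ) : HasDerivAt (fun t => bernsteinCurve δ ρ₀ ρ₁ t κ)
      (laplacian δ (bernsteinFlux δ ρ₀ ρ₁ s) κ) s := by
  rw [laplacian_bernsteinFlux hδ h₀ h₁]
  have hx := hasDerivAt_id' s
  have ha := ((((hx.const_sub 1).pow 3).mul ((hx.const_mul 3).const_add 1)).mul_const (ρ₀ κ))
  have hb := (((hx.pow 3).mul ((hx.const_mul 3).const_sub 4)).mul_const (ρ₁ κ))
  have hc := ((((hx.pow 2).const_mul 6).mul ((hx.const_sub 1).pow 2)).mul_const (expDensity δ κ))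
  refine ((ha.add hb).add hc).congr_deriv ?_
  simp
  ring

theorem isConnectingCurve_bernstein (hα : 0 < α) (hδ : 0 < δ) (h₀ : ρ₀ ∈ probTwoC δ)
    (h₁ : ρ₁ ∈ probTwoC δ) (hG₀ : HasGaussMoment α δ ρ₀) (hG₁ : HasGaussMoment α δ ρ₁) :
    IsConnectingCurve δ ρ₀ ρ₁ (bernsteinCurve δ ρ₀ ρ₁) (bernsteinFlux δ ρ₀ ρ₁) where
  mem_ell1 s _ := add_mem_ell1TwoC (add_mem_ell1TwoC (const_mul_mem_ell1TwoC _ h₀.1)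
    (const_mul_mem_ell1TwoC _ h₁.1)) (const_mul_mem_ell1TwoC _ (expDensity_mem hδ).1)
  mem_ell2 s _ := ((memℓp_potential hα hδ h₀ hG₀).const_mul _).add
    ((memℓp_potential hα hδ h₁ hG₁).const_mul _)
  memH1 κ := by
    refine MemH1.of_hasDerivAt (hasDerivAt_bernsteinCurve hδ h₀ h₁ κ) ?_
    simp only [laplacian_bernsteinFlux hδ h₀ h₁]
    fun_prop
  memL2 κ := by
    refine memLp_two_of_continuous ?_
    unfold bernsteinFlux
    fun_prop
  diffusion κ := Filter.Eventually.of_forall (hasDerivAt_bernsteinCurve hδ h₀ h₁ κ)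
  left := by funext κ; simp [bernsteinCurve]
  right := by funext κ; simp [bernsteinCurve]; norm_num

theorem quadOver_zero_le_zero {r : ℝ} (hr : 0 ≤ r) : quadOver 0 r = 0 := by
  unfold quadOver
  split_ifs with h1 h2
  · simp
  · rfl
  · exact absurd ⟨le_antisymm (not_lt.1 h1) hr, rfl⟩ h2

theorem quadOver_bernstein_le (hδ : 0 < δ) (h₀ : ρ₀ ∈ probTwoC δ) (h₁ : ρ₁ ∈ probTwoC δ)
    {s : ℝ} (hs : s ∈ Icc (0 : ℝ) 1) (κ : ℤ) :
    quadOver (bernsteinFlux δ ρ₀ ρ₁ s κ) (bernsteinCurve δ ρ₀ ρ₁ s κ) ≤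
      ENNReal.ofReal (24 * (potential δ ρ₀ κ ^ 2 / expDensity δ κ +
        potential δ ρ₁ κ ^ 2 / expDensity δ κ)) := by
  obtain ⟨hs0, hs1⟩ := hs
  have hp₀ := h₀.2.1 κ
  have hp₁ := h₁.2.1 κ
  have hg := expDensity_pos hδ κ
  have hs1' : 0 ≤ 1 - s := by linarith
  have hs4 : 0 ≤ 4 - 3 * s := by linarith
  have hge : 6 * s ^ 2 * (1 - s) ^ 2 * expDensity δ κ ≤ bernsteinCurve δ ρ₀ ρ₁ s κ := by
    have : 0 ≤ (1 - s) ^ 3 * (1 + 3 * s) * ρ₀ κ + s ^ 3 * (4 - 3 * s) * ρ₁ κ := by positivity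
    rw [bernsteinCurve]
    linarith
  by_cases h : s = 0 ∨ s = 1
  -- At the end points the weight of the reference density is zero and the curve itself may vanish;
  -- the convention 0²/0 = 0 applies.
  · have : bernsteinFlux δ ρ₀ ρ₁ s κ = 0 := by
      rcases h with rfl | rfl <;> simp [bernsteinFlux]
    rw [this, quadOver_zero_le_zero (le_trans (by positivity) hge)]
    exact zero_le
  push Not at h
  have hs0' : 0 < s := lt_of_le_of_ne hs0 h.1.symm
  have hs1'' : 0 < 1 - s := sub_pos.2 (lt_of_le_of_ne hs1 h.2)
  have hpos : 0 < 6 * s ^ 2 * (1 - s) ^ 2 * expDensity δ κ := by positivity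
  rw [quadOver, if_pos (hpos.trans_le hge)]
  refine ENNReal.ofReal_le_ofReal ((div_le_div_of_nonneg_left (sq_nonneg _) hpos hge).trans ?_)
  rw [bernsteinFlux, ← add_div, mul_div_assoc', div_le_div_iff₀ hpos hg]
  generalize potential δ ρ₀ κ = u, potential δ ρ₁ κ = v
  -- The flux is 12s(1 - s) times this combination; against the lower bound 6s²(1 - s)² for the
  -- weight, the constant is 144/6 = 24.
  have key : ((1 - s) * u - s * v) ^ 2 ≤ u ^ 2 + v ^ 2 := by
    have e : u ^ 2 + v ^ 2 - ((1 - s) * u - s * v) ^ 2 =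
      s * (1 - s) * (u + v) ^ 2 + s * u ^ 2 + (1 - s) * v ^ 2 := by ring
    have : 0 ≤ s * (1 - s) * (u + v) ^ 2 + s * u ^ 2 + (1 - s) * v ^ 2 := by positivity
    linarith
  calc _ = 144 * s ^ 2 * (1 - s) ^ 2 * expDensity δ κ * ((1 - s) * u - s * v) ^ 2 := by ring
    _ ≤ 144 * s ^ 2 * (1 - s) ^ 2 * expDensity δ κ * (u ^ 2 + v ^ 2) := by gcongr
    _ = _ := by ring

theorem action_bernstein_le (hα : 0 < α) (hδ : 0 < δ) (h₀ : ρ₀ ∈ probTwoC δ)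
    (h₁ : ρ₁ ∈ probTwoC δ) (hG₀ : HasGaussMoment α δ ρ₀) (hG₁ : HasGaussMoment α δ ρ₁) :
    action δ (bernsteinCurve δ ρ₀ ρ₁) (bernsteinFlux δ ρ₀ ρ₁) ≤
      ENNReal.ofReal (24 * (1024 * momentBound α (gaussMoment α δ ρ₀) ^ 2 +
        1024 * momentBound α (gaussMoment α δ ρ₁) ^ 2)) := by
  obtain ⟨hs₀, hl₀⟩ := summable_potential_sq_div_and_le hα hδ h₀ hG₀
  obtain ⟨hs₁, hl₁⟩ := summable_potential_sq_div_and_le hα hδ h₁ hG₁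
  have hint : ∀ κ : ℤ, ∫⁻ s in Icc (0 : ℝ) 1,
      quadOver (bernsteinFlux δ ρ₀ ρ₁ s κ) (bernsteinCurve δ ρ₀ ρ₁ s κ) ≤
        ENNReal.ofReal (24 * (potential δ ρ₀ κ ^ 2 / expDensity δ κ +
          potential δ ρ₁ κ ^ 2 / expDensity δ κ)) := by
    intro κ
    refine (setLIntegral_mono measurable_const
      fun s hs => quadOver_bernstein_le hδ h₀ h₁ hs κ).trans_eq ?_
    rw [setLIntegral_const]
    simp
  have hnn : ∀ κ : ℤ, 0 ≤ 24 * (potential δ ρ₀ κ ^ 2 / expDensity δ κ +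
      potential δ ρ₁ κ ^ 2 / expDensity δ κ) := fun κ => by
    have := expDensity_pos hδ κ
    positivity
  calc _ ≤ ENNReal.ofReal δ * ∑' κ : ℤ, ENNReal.ofReal (24 * (potential δ ρ₀ κ ^ 2 /
          expDensity δ κ + potential δ ρ₁ κ ^ 2 / expDensity δ κ)) :=
        mul_le_mul_right (ENNReal.tsum_le_tsum hint) _
    _ = ENNReal.ofReal (24 * (δ * ∑' κ : ℤ, potential δ ρ₀ κ ^ 2 / expDensity δ κ +
          δ * ∑' κ : ℤ, potential δ ρ₁ κ ^ 2 / expDensity δ κ)) := by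
        rw [← ENNReal.ofReal_tsum_of_nonneg hnn ((hs₀.add hs₁).mul_left 24),
          ← ENNReal.ofReal_mul hδ.le, tsum_mul_left, hs₀.tsum_add hs₁]
        ring_nf
    _ ≤ _ := ENNReal.ofReal_le_ofReal (by linarith)

end Curve

end DiffusiveTransport

end

theorem mainTheorem3 (α : ℝ) (hα : 0 < α) :
    ∃ A : ℝ → ℝ → ℝ≥0, ∀ δ : ℝ, 0 < δ →
      ∀ ρ₀ ∈ DiffusiveTransport.probTwoC δ, ∀ ρ₁ ∈ DiffusiveTransport.probTwoC δ,
        DiffusiveTransport.HasGaussMoment α δ ρ₀ → DiffusiveTransport.HasGaussMoment α δ ρ₁ →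
          ∃ ρ w : ℝ → ℤ → ℝ, DiffusiveTransport.IsConnectingCurve δ ρ₀ ρ₁ ρ w ∧
            DiffusiveTransport.action δ ρ w ≤
              (A (DiffusiveTransport.gaussMoment α δ ρ₀) (DiffusiveTransport.gaussMoment α δ ρ₁) :
                ℝ≥0∞) := by
  refine ⟨fun R₀ R₁ => (24 * (1024 * DiffusiveTransport.momentBound α R₀ ^ 2 +
    1024 * DiffusiveTransport.momentBound α R₁ ^ 2)).toNNReal, ?_⟩
  intro δ hδ ρ₀ h₀ ρ₁ h₁ hG₀ hG₁
  exact ⟨_, _, DiffusiveTransport.isConnectingCurve_bernstein hα hδ h₀ h₁ hG₀ hG₁,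
    DiffusiveTransport.action_bernstein_le hα hδ h₀ h₁ hG₀ hG₁⟩
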